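/- Let $F_n$ be the free group of rank $n$; an element of $F_n$ is called primitive if it belongs to some free basis of $F_n$. A matrix $g\in\mathrm{GL}(d,\mathbb{C})$ is called unipotent if its characteristic polynomial is $(x-1)^d$. Let $\mathcal{U}(n,d)$ be the set of representations $\rho:F_n\to\mathrm{GL}(d,\mathbb{C})$ such that $\rho(x)$ is unipotent for every $x\in F_n$, and let $\mathcal{PU}(n,d)\supseteq\mathcal{U}(n,d)$ be the set of representations $\rho:F_n\to\mathrm{GL}(d,\mathbb{C})$ such that $\rho(p)$ is unipotent for every primitive $p\in F_n$. Both are considered as subvarieties of $\mathrm{Hom}(F_n,\mathrm{GL}(d,\mathbb{C}))=\mathrm{GL}(d,\mathbb{C})^n$ with the Zariski topology. Theorem. For every $n\ge 3$ and every $d$, the variety $\mathcal{PU}(n,d)$ is irreducible if and only if $\mathcal{U}(n,d)=\mathcal{PU}(n,d)$. In particular, the conjecture that $\mathcal{PU}(n,d)$ is irreducible for all $n\ge 3$ and all $d$ is equivalent to the Platonov--Potapchik conjecture that $\mathcal{U}(n,d)=\mathcal{PU}(n,d)$ for all $n\ge 3$ and all $d$. -/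

import Mathlib

open Polynomial

namespace PrimUnip

/-- `U(d)`: the unipotent matrices in `GL(d, ℂ)`, i.e. those with characteristic polynomial
`(X - 1) ^ d`. -/
def unipotents (d : ℕ) : Set (Matrix.GeneralLinearGroup (Fin d) ℂ) :=
  {g | (g : Matrix (Fin d) (Fin d) ℂ).charpoly = (X - 1) ^ d}

/-- `Hom(F_n, GL(d, ℂ))`: the `d`-dimensional complex representations of the free group `F_n`. -/
abbrev Rep (n d : ℕ) : Type :=
  FreeGroup (Fin n) →* Matrix.GeneralLinearGroup (Fin d) ℂ

/-- The set `P_n` of primitive elements of `F_n`: those that belong to some free basis of `F_n`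
(all free bases of `F_n` have `n` elements, so they may be indexed by `Fin n`). -/
def primitives (n : ℕ) : Set (FreeGroup (Fin n)) :=
  {p | ∃ b : FreeGroupBasis (Fin n) (FreeGroup (Fin n)), p ∈ Set.range b}

/-- `𝒰(n, d)`: the representations all of whose values are unipotent. -/
def unipotentReps (n d : ℕ) : Set (Rep n d) :=
  {ρ | ∀ x : FreeGroup (Fin n), ρ x ∈ unipotents d}

/-- `𝒫𝒰(n, d)`: the representations that send every primitive element to a unipotent. -/
def primitiveUnipotentReps (n d : ℕ) : Set (Rep n d) :=
  {ρ | ∀ p ∈ primitives n, ρ p ∈ unipotents d}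

/-- The common zeros in `ℂ^σ` of a set of polynomials. -/
def zeros {σ : Type} (S : Set (MvPolynomial σ ℂ)) : Set (σ → ℂ) :=
  {x | ∀ f ∈ S, MvPolynomial.eval x f = 0}

/-- The Zariski topology on the affine space `ℂ^σ`: the closed sets are the common zero sets of
sets of polynomials. -/
@[reducible] def zariski (σ : Type) : TopologicalSpace (σ → ℂ) :=
  TopologicalSpace.ofClosed {Z | ∃ S : Set (MvPolynomial σ ℂ), Z = zeros S}
    ⟨{1}, by ext x; simp [zeros]⟩
    (by
      intro A hA
      refine ⟨{f | ∃ S : Set (MvPolynomial σ ℂ), zeros S ∈ A ∧ f ∈ S}, ?_⟩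
      ext x
      constructor
      · rintro hx f ⟨S, hS, hf⟩
        exact hx _ hS f hf
      · intro hx Z hZ
        obtain ⟨S, rfl⟩ := hA hZ
        exact fun f hf => hx f ⟨S, hZ, hf⟩)
    (by
      rintro _ ⟨S, rfl⟩ _ ⟨T, rfl⟩
      refine ⟨{h | ∃ f ∈ S, ∃ g ∈ T, h = f * g}, ?_⟩
      ext x
      constructor
      · rintro (hx | hx) _ ⟨f, hf, g, hg, rfl⟩
        · simp [hx f hf]
        · simp [hx g hg]
      · intro hx
        by_contra hne
        simp only [zeros, Set.mem_union, Set.mem_ofPred_eq, not_or, not_forall] at hne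
        obtain ⟨⟨f, hf, hfx⟩, ⟨g, hg, hgx⟩⟩ := hne
        have := hx (f * g) ⟨f, hf, g, hg, rfl⟩
        rw [map_mul] at this
        exact (mul_ne_zero hfx hgx) this)

/-- The matrix entries of `ρ(x_1), …, ρ(x_n)`. This identifies `Hom(F_n, GL(d, ℂ)) = GL(d, ℂ)^n`
with a (principal) Zariski open subset of affine space. -/
def coords (n d : ℕ) (ρ : Rep n d) : Fin n × Fin d × Fin d → ℂ :=
  fun e => (ρ (FreeGroup.of e.1) : Matrix (Fin d) (Fin d) ℂ) e.2.1 e.2.2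

/-- The Zariski topology on the representation variety `Hom(F_n, GL(d, ℂ)) = GL(d, ℂ)^n`. -/
@[reducible] def repZariski (n d : ℕ) : TopologicalSpace (Rep n d) :=
  (zariski (Fin n × Fin d × Fin d)).induced (coords n d)

/-- A set of representations is irreducible in the Zariski topology: it is non-empty, and it is
not covered by two Zariski closed sets unless it lies in one of them. -/
def ZariskiIrreducible {n d : ℕ} (V : Set (Rep n d)) : Prop :=
  @IsIrreducible _ (repZariski n d) V

end PrimUnip

/-! By Kolchin's theorem a representation lies in `𝒰(n, d)` exactly when its generators are
simultaneously conjugate to matrices `1 + T i` with `T i` strictly lower triangular. The pairs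
(change of basis, tuple `T`) fill an open part of a linear space, so any two points of `𝒰(n, d)` lie
on a rational curve inside it. Hence `𝒰(n, d)` is always irreducible, and equality with `𝒫𝒰(n, d)`
gives irreducibility.

Conversely, let `𝒫𝒰(n, d)` be irreducible, and call the generators `x₀, x₁, x₂, …`. Every `x₀ h`,
with `h` a word in the other generators, is primitive, so on any invariant subquotient the trace is
constant on the coset `x₀⟨x₁, x₂, …⟩`. By Burnside's theorem and nondegeneracy of the trace form,
`⟨x₁, x₂, …⟩` then acts reducibly once the subquotient has dimension at least two
(`exists_invariant_between`).

Let `N = ρ(x₁) - 1`. Where `N ^ (d - 1) ≠ 0`, a non-empty open condition, the only `N`-invariant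
subspaces are the `ker N ^ j`, so the subspace just found is one of them. Its invariance under a
generator is the closed condition `N ^ j * ρ(x_i) * N ^ (d - j) = 0`. Finitely many closed sets thus
cover `𝒫𝒰(n, d)`, and irreducibility makes one `j` serve all representations. Swapping `x₀` and
`x₂`, which is possible because `n ≥ 3`, fixes `N` and extends the condition to `x₀`.

Repeating this in the remaining gaps yields a complete flag invariant under all generators at every
regular point (`subset_invariantLocus`), so regular points lie in `𝒰(n, d)`. Density of the regular
points gives the rest. -/

namespace PrimUnip

/-! ### Burnside's theorem, constant traces and reducibility. -/

section LinearAlgebra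

open Module

variable {K : Type*} [Field K]

/-- Burnside's theorem: the operators of an irreducible finite-dimensional representation over an
algebraically closed field span the whole endomorphism algebra. -/
theorem asAlgebraHom_surjective [IsAlgClosed K] {H W : Type*} [Monoid H] [AddCommGroup W]
    [Module K W] [FiniteDimensional K W] (σ : Representation K H W) [σ.IsIrreducible] :
    Function.Surjective σ.asAlgebraHom := by
  classical
  intro f
  have : FiniteDimensional K σ.asModule := inferInstanceAs (FiniteDimensional K W)
  let R := MonoidAlgebra K H
  -- By Schur's lemma the commutant consists of scalars, so every linear `f` commutes with it and
  -- Jacobson density applies to `f` on a basis.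
  have hb : Function.Bijective (algebraMap K (End R σ.asModule)) :=
    IsSimpleModule.algebraMap_end_bijective_of_isAlgClosed K
  let e : σ.asModule ≃ₗ[K] W := σ.asModuleEquiv
  let F : End (End R σ.asModule) σ.asModule :=
    { toFun := fun v => e.symm (f (e v))
      map_add' := by simp
      map_smul' := by
        intro φ v
        obtain ⟨c, rfl⟩ := hb.2 φ
        simp }
  let b := finBasis K W
  obtain ⟨r, hr⟩ := jacobson_density F (Finset.univ.image fun i => e.symm (b i))
  refine ⟨r, b.ext fun i => ?_⟩
  have := hr (e.symm (b i)) (by simp)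
  have h2 := congrArg e this
  have h3 := σ.asModuleEquiv_map_smul r (e.symm (b i))
  simp only [F, LinearMap.coe_mk, AddHom.coe_mk, LinearEquiv.apply_symm_apply] at h2
  rw [h2]
  rw [LinearEquiv.apply_symm_apply] at h3
  exact h3.symm

/-- If the trace is constant on a coset `g * σ H` of a linear monoid, with `g` invertible, then the
monoid acts reducibly, unless the space is a line. -/
theorem exists_invariant_of_trace_const [IsAlgClosed K] {H W : Type*} [Monoid H] [AddCommGroup W]
    [Module K W] [FiniteDimensional K W] (σ : Representation K H W) {g : End K W} (hg : IsUnit g)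
    (c : K) (ht : ∀ h, LinearMap.trace K W (g * σ h) = c) (hd : 2 ≤ finrank K W) :
    ∃ p : Submodule K W, p ≠ ⊥ ∧ p ≠ ⊤ ∧ ∀ h, p ≤ p.comap (σ h) := by
  by_contra! hcon
  have : Nontrivial W := Module.nontrivial_of_finrank_pos (R := K) (by omega)
  have hirr : σ.IsIrreducible := by
    have hsub : ∀ p : Subrepresentation σ, p.toSubmodule = ⊥ ∨ p.toSubmodule = ⊤ := by
      intro p
      by_contra! h
      obtain ⟨x, hx⟩ := hcon _ h.1 h.2
      exact hx fun v hv => p.apply_mem_toSubmodule x hv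
    refine { exists_pair_ne := ⟨⊥, ⊤, fun h => ?_⟩, eq_bot_or_eq_top := fun p => ?_ }
    · have := congrArg Subrepresentation.toSubmodule h
      exact bot_ne_top (α := Submodule K W) this
    · exact (hsub p).imp (fun h => Subrepresentation.toSubmodule_injective h)
        (fun h => Subrepresentation.toSubmodule_injective h)
  -- For `f = σ a` this is a difference of two traces over the coset; by Burnside such `f` span all
  -- endomorphisms.
  have hzero : ∀ (h : H) (f : End K W), LinearMap.trace K W (g * f * (σ h - 1)) = 0 := by
    intro h f
    obtain ⟨r, rfl⟩ := asAlgebraHom_surjective σ f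
    induction r using MonoidAlgebra.induction_linear with
    | zero => simp
    | add x y hx hy => rw [map_add, mul_add, add_mul, map_add, hx, hy, add_zero]
    | single a k =>
      rw [Representation.asAlgebraHom_single, mul_smul_comm, smul_mul_assoc, map_smul, mul_sub,
        mul_assoc, ← map_mul, mul_one, map_sub, ht, ht, sub_self, smul_zero]
  have hone : ∀ h, σ h = 1 := by
    intro h
    -- The trace form is nondegenerate; rank-one operators suffice to test it. Once `σ` is trivial,
    -- every line is invariant.
    have : (σ h - 1) * g = 0 := by
      ext w
      rw [LinearMap.zero_apply, ← Module.forall_dual_apply_eq_zero_iff K]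
      intro φ
      have h1 := hzero h (φ.smulRight w)
      rw [mul_assoc, LinearMap.trace_mul_comm, mul_assoc, LinearMap.trace_mul_comm] at h1
      have h2 : (σ h - 1) * g * φ.smulRight w = φ.smulRight (((σ h - 1) * g) w) := by
        ext v; simp
      rw [← LinearMap.trace_smulRight, ← h2]
      exact h1
    rw [← sub_eq_zero]
    exact (hg.mul_left_eq_zero).1 this
  obtain ⟨v, hv⟩ := exists_ne (0 : W)
  obtain ⟨h, hh⟩ := hcon (K ∙ v) (by simpa using hv) (by
    intro h
    have := finrank_span_singleton (K := K) hv
    rw [h, finrank_top] at this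
    omega)
  exact hh (by rw [hone]; exact le_rfl)

/-- The operator induced on a subquotient by a unipotent operator is unipotent. -/
theorem isNilpotent_subquotient_sub_one {G V : Type*} [Monoid G] [AddCommGroup V] [Module K V]
    (σ : Representation K G V) (p q : Submodule K V)
    (hq : ∀ g, q ≤ q.comap (σ g)) (hp' : ∀ g, p.comap q.subtype ≤ (p.comap q.subtype).comap
      (σ.subrepresentation q hq g)) (g : G) (hg : IsNilpotent (σ g - 1)) :
    IsNilpotent ((σ.subrepresentation q hq).quotient (p.comap q.subtype) hp' g - 1) := by
  obtain ⟨k, hk⟩ := hg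
  refine ⟨k, ?_⟩
  -- Powers on the quotient are computed on representatives in `q`, where the `k`-th power vanishes.
  have key : ∀ (j : ℕ) (v : q), ∃ w : q, (w : V) = ((σ g - 1) ^ j) v ∧
      (((σ.subrepresentation q hq).quotient (p.comap q.subtype) hp' g - 1) ^ j)
        (Submodule.Quotient.mk v) = Submodule.Quotient.mk w := by
    intro j
    induction j with
    | zero => exact fun v => ⟨v, by simp, by simp⟩
    | succ j ih =>
      intro v
      obtain ⟨w, hw, hw'⟩ := ih v
      refine ⟨σ.subrepresentation q hq g w - w, ?_, ?_⟩
      · rw [pow_succ', Module.End.mul_apply, ← hw]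
        simp
      · rw [pow_succ', Module.End.mul_apply, hw']
        simp
  ext v
  obtain ⟨w, hw, hw'⟩ := key k v
  have hw0 : w = 0 := by ext; rw [hw, hk]; simp
  simp only [LinearMap.comp_apply, Submodule.mkQ_apply] at hw' ⊢
  rw [hw', hw0]
  simp

theorem trace_eq_finrank_of_isNilpotent_sub_one {W : Type*} [AddCommGroup W] [Module K W]
    [FiniteDimensional K W] {f : End K W} (hf : IsNilpotent (f - 1)) :
    LinearMap.trace K W f = finrank K W := by
  have := (LinearMap.isNilpotent_trace_of_isNilpotent hf).eq_zero
  rw [map_sub, LinearMap.trace_one, sub_eq_zero] at this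
  exact this

/-- Between two invariant subspaces whose dimensions differ by at least two there is a further
subspace invariant under `ι H`, provided that some coset `g * ι H` acts unipotently. -/
theorem exists_invariant_between [IsAlgClosed K] {G H V : Type*} [Group G] [Group H]
    [AddCommGroup V] [Module K V] [FiniteDimensional K V] (σ : Representation K G V) (ι : H →* G)
    (g : G) (hg : ∀ h, IsNilpotent (σ (g * ι h) - 1)) (p q : Submodule K V) (hpq : p ≤ q)
    (hp : ∀ g, p ≤ p.comap (σ g)) (hq : ∀ g, q ≤ q.comap (σ g))
    (hd : finrank K p + 2 ≤ finrank K q) :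
    ∃ r : Submodule K V, p < r ∧ r < q ∧ ∀ h, r ≤ r.comap (σ (ι h)) := by
  have hp' : ∀ g, p.comap q.subtype ≤ (p.comap q.subtype).comap
      (σ.subrepresentation q hq g) := fun g v hv => hp g hv
  set p' := p.comap q.subtype with hp'def
  let τ := (σ.subrepresentation q hq).quotient p' hp'
  have hfin : finrank K (q ⧸ p') = finrank K q - finrank K p := by
    have h1 := p'.finrank_quotient_add_finrank
    have h2 : finrank K p' = finrank K p := (Submodule.comapSubtypeEquivOfLe hpq).finrank_eq
    omega
  have hu : IsUnit (τ g) := (Group.isUnit g).map τ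
  obtain ⟨r, hr0, hr1, hr⟩ := exists_invariant_of_trace_const (τ.comp ι) hu
    (finrank K (q ⧸ p') : K) (fun h => by
      have := isNilpotent_subquotient_sub_one σ p q hq hp' (g * ι h) (hg h)
      rw [MonoidHom.comp_apply, ← map_mul]
      exact trace_eq_finrank_of_isNilpotent_sub_one this) (by omega)
  have hker : p' ≤ r.comap p'.mkQ := by
    intro v hv
    have : p'.mkQ v = 0 := by simpa using hv
    rw [Submodule.mem_comap, this]
    exact r.zero_mem
  refine ⟨(r.comap p'.mkQ).map q.subtype, ?_, ?_, ?_⟩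
  · refine lt_of_le_of_ne (fun v hv => ⟨⟨v, hpq hv⟩, hker hv, rfl⟩) fun h => hr0 ?_
    rw [eq_bot_iff]
    intro v hv
    obtain ⟨w, rfl⟩ := p'.mkQ_surjective v
    have : (w : V) ∈ p := by rw [h]; exact ⟨w, hv, rfl⟩
    have h2 : w ∈ p' := this
    simpa using h2
  · refine lt_of_le_of_ne ?_ fun h => hr1 ?_
    · rintro _ ⟨w, -, rfl⟩
      exact w.2
    · rw [eq_top_iff]
      rintro v -
      obtain ⟨w, rfl⟩ := p'.mkQ_surjective v
      have : (w : V) ∈ (r.comap p'.mkQ).map q.subtype := by rw [h]; exact w.2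
      obtain ⟨w', hw', hww⟩ := this
      have : w' = w := Subtype.ext hww
      exact this ▸ hw'
  · rintro h _ ⟨w, hw, rfl⟩
    exact ⟨σ.subrepresentation q hq (ι h) w, hr h hw, rfl⟩

/-- A nilpotent operator preserving a hyperplane `p` of `q` maps `q` to `p`. -/
theorem map_le_of_isNilpotent {V : Type*} [AddCommGroup V] [Module K V] [FiniteDimensional K V]
    {N : End K V} (hN : IsNilpotent N) {p q : Submodule K V} (hpq : p ≤ q)
    (hp : p.map N ≤ p) (hq : q.map N ≤ q) (hd : finrank K p + 1 = finrank K q) :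
    q.map N ≤ p := by
  by_contra hcon
  have hsup : q.map N ⊔ p = q := by
    refine Submodule.eq_of_le_of_finrank_le (sup_le hq hpq) ?_
    have : p < q.map N ⊔ p := lt_of_le_of_ne le_sup_right fun h => hcon (h ▸ le_sup_left)
    have := Submodule.finrank_lt_finrank_of_lt this
    omega
  -- Iterating `q = N q + p` gives `q ≤ N ^ k q + p` for all `k`, which nilpotency contradicts.
  have hpow : ∀ k : ℕ, q ≤ q.map (N ^ k) ⊔ p := by
    intro k
    induction k with
    | zero => simp [Module.End.one_eq_id]
    | succ k ih =>
      have h1 := Submodule.map_mono (f := N) ih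
      rw [Submodule.map_sup, ← Submodule.map_comp, ← Module.End.mul_eq_comp, ← pow_succ'] at h1
      calc q = q.map N ⊔ p := hsup.symm
        _ ≤ (q.map (N ^ (k + 1)) ⊔ p.map N) ⊔ p := sup_le_sup_right h1 _
        _ ≤ _ := by rw [sup_assoc]; exact sup_le_sup_left (sup_le hp le_rfl) _
  obtain ⟨k, hk⟩ := hN
  have := hpow k
  rw [hk, Submodule.map_zero, bot_sup_eq] at this
  have := Submodule.finrank_mono this
  omega

end LinearAlgebra

/-! ### Kolchin's theorem and invariant flags of a regular nilpotent. -/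

section Flags

open Module

variable {K : Type*} [Field K]

/-- Kolchin's theorem: a representation by unipotent operators is strictly triangular, up to the
identity, in a suitable basis. -/
theorem exists_basis_of_isNilpotent_sub_one [IsAlgClosed K] {G V : Type*} [Group G]
    [AddCommGroup V] [Module K V] [FiniteDimensional K V] (σ : Representation K G V)
    (hσ : ∀ g, IsNilpotent (σ g - 1)) (k : ℕ) (q : Submodule K V) (hq : ∀ g, q ≤ q.comap (σ g))
    (hk : finrank K q = k) :
    ∃ b : Basis (Fin k) K q, ∀ g j, σ g (b j : V) - b j ∈
      Submodule.span K ((fun i => (b i : V)) '' Set.Ioi j) := by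
  induction k generalizing q with
  | zero => exact ⟨finBasisOfFinrankEq K q hk, fun g j => j.elim0⟩
  | succ k ih =>
    -- A maximal proper invariant subspace of `q` has codimension one: otherwise the coset argument
    -- for the whole group, with `g = 1`, would give a larger one.
    obtain ⟨p, ⟨hpq, hp⟩, hmax⟩ := (wellFounded_gt (α := Submodule K V)).has_min
      {p | p < q ∧ ∀ g, p ≤ p.comap (σ g)}
      ⟨⊥, bot_lt_iff_ne_bot.2 (by rintro rfl; simp at hk), fun g => bot_le⟩
    have hpk : finrank K p = k := by
      have h1 := Submodule.finrank_lt_finrank_of_lt hpq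
      by_contra hne
      obtain ⟨r, hpr, hrq, hr⟩ := exists_invariant_between σ (MonoidHom.id G) 1
        (fun h => by simpa using hσ h) p q hpq.le hp hq (by omega)
      exact hmax r ⟨hrq, hr⟩ hpr
    obtain ⟨b, hb⟩ := ih p hp hpk
    obtain ⟨y, hyq, hyp⟩ := SetLike.exists_of_lt hpq
    have hsup : p ⊔ K ∙ y = q := by
      refine Submodule.eq_of_le_of_finrank_le
        (sup_le hpq.le ((Submodule.span_singleton_le_iff_mem _ _).2 hyq)) ?_
      have : p < p ⊔ K ∙ y := lt_of_le_of_ne le_sup_left fun h =>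
        hyp (h ▸ (le_sup_right : K ∙ y ≤ _) (Submodule.mem_span_singleton_self y))
      have := Submodule.finrank_lt_finrank_of_lt this
      omega
    have hspan : Submodule.span K (Set.range fun i => (b i : V)) = p := by
      have := congrArg (Submodule.map p.subtype) b.span_eq
      rwa [Submodule.map_span, ← Set.range_comp, Submodule.map_top, Submodule.range_subtype] at this
    -- The new vector comes first, so that triangularity is lower.
    let b' := Basis.mkFinConsOfLE y hyq b hpq.le
      (by
        intro c x hx h
        by_contra hc
        refine hyp ?_
        have : y = -(c⁻¹ • x) := by
          rw [eq_neg_iff_add_eq_zero, ← inv_smul_smul₀ hc y, ← smul_add, h, smul_zero]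
        rw [this]
        exact p.neg_mem (p.smul_mem _ hx))
      (by
        intro z hz
        rw [← hsup, Submodule.mem_sup] at hz
        obtain ⟨x, hx, w, hw, rfl⟩ := hz
        obtain ⟨c, rfl⟩ := Submodule.mem_span_singleton.1 hw
        exact ⟨-c, by simpa using hx⟩)
    have hb0 : (b' 0 : V) = y := by simp [b']
    have hbs : ∀ i : Fin k, (b' i.succ : V) = b i := by intro i; simp [b']
    refine ⟨b', fun g j => ?_⟩
    refine Fin.cases ?_ (fun j => ?_) j
    · have h1 : q.map (σ g - 1) ≤ p := by
        refine map_le_of_isNilpotent (hσ g) hpq.le ?_ ?_ (by omega)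
        · rintro _ ⟨v, hv, rfl⟩
          exact p.sub_mem (hp g hv) hv
        · rintro _ ⟨v, hv, rfl⟩
          exact q.sub_mem (hq g hv) hv
      have h2 : σ g y - y ∈ p := h1 ⟨y, hyq, rfl⟩
      rw [hb0]
      rw [← hspan] at h2
      refine Submodule.span_mono ?_ h2
      rintro _ ⟨i, rfl⟩
      exact ⟨i.succ, Fin.succ_pos i, hbs i⟩
    · rw [hbs]
      refine Submodule.span_mono ?_ (hb g j)
      rintro _ ⟨i, hi, rfl⟩
      exact ⟨i.succ, Fin.succ_lt_succ_iff.2 hi, hbs i⟩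

/-- A subspace invariant under free generators is invariant under the whole free group. -/
theorem le_comap_of_forall_of {α V : Type*} [AddCommGroup V] [Module K V] [FiniteDimensional K V]
    (σ : Representation K (FreeGroup α) V) (p : Submodule K V)
    (hp : ∀ i, p ≤ p.comap (σ (FreeGroup.of i))) (g : FreeGroup α) : p ≤ p.comap (σ g) := by
  induction g using FreeGroup.induction_on with
  | C1 => simp [Module.End.one_eq_id]
  | of i => exact hp i
  | inv_of i _ =>
    have hinj : Function.Injective (σ (FreeGroup.of i)) := (σ.apply_bijective _).1
    -- An injective endomorphism of a finite-dimensional `p` is onto, so the inverse preserves `p`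
    -- too.
    have hmap : p.map (σ (FreeGroup.of i)) = p :=
      Submodule.eq_of_le_of_finrank_le (Submodule.map_le_iff_le_comap.2 (hp i))
        (LinearEquiv.finrank_eq (Submodule.equivMapOfInjective _ hinj p)).le
    intro v hv
    rw [← hmap] at hv
    obtain ⟨w, hw, rfl⟩ := hv
    simpa using hw
  | mul x y hx hy =>
    intro v hv
    rw [Submodule.mem_comap, map_mul]
    exact hx (hy hv)

/-- If the free generators act unipotently along a filtration, so does the whole free group. -/
theorem sub_one_pow_eq_zero_of_filtration {α V : Type*} [AddCommGroup V] [Module K V]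
    (σ : Representation K (FreeGroup α) V) (F : ℕ → Submodule K V) (hF : Monotone F)
    (h0 : F 0 = ⊥) {d : ℕ} (hd : F d = ⊤)
    (hi : ∀ i j, ∀ v ∈ F (j + 1), σ (FreeGroup.of i) v - v ∈ F j) (g : FreeGroup α) :
    (σ g - 1) ^ d = 0 := by
  have hg : ∀ j, ∀ v ∈ F (j + 1), σ g v - v ∈ F j := by
    induction g using FreeGroup.induction_on with
    | C1 => intro j v _; simp
    | of i => exact hi i
    | inv_of i h =>
      -- Uses `x⁻¹ v = v - x⁻¹ (x v - v)`, where `x v - v` lies one step lower.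
      have hinv : ∀ j, ∀ v ∈ F j, σ (FreeGroup.of i)⁻¹ v ∈ F j := by
        intro j
        induction j with
        | zero => simp [h0]
        | succ j ih =>
          intro v hv
          have := (F (j + 1)).sub_mem hv (hF j.le_succ (ih _ (h j v hv)))
          simpa using this
      intro j v hv
      have := (F j).neg_mem (hinv j _ (h j v hv))
      simpa using this
    | mul x y hx hy =>
      intro j v hv
      have h1 := hy j v hv
      have h2 : σ y v ∈ F (j + 1) := by
        simpa using (F (j + 1)).add_mem (hF j.le_succ h1) hv
      have := (F j).add_mem (hx j _ h2) h1
      simpa using this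
  have hpow : ∀ k j, j + k = d → ∀ v, ((σ g - 1) ^ k) v ∈ F j := by
    intro k
    induction k with
    | zero => intro j hj v; simp [show j = d by omega, hd]
    | succ k ih =>
      intro j hj v
      rw [pow_succ', Module.End.mul_apply]
      exact hg j _ (ih (j + 1) (by omega) v)
  ext v
  have := hpow d 0 (by omega) v
  rw [h0, Submodule.mem_bot] at this
  simp [this]

/-- For a regular nilpotent `N` in dimension `d`, the kernel of `N ^ k` has dimension `k`. -/
theorem finrank_ker_pow_of_regular {V : Type*} [AddCommGroup V] [Module K V]
    [FiniteDimensional K V] {N : End K V} {d : ℕ} (hV : finrank K V = d) (hN : N ^ d = 0)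
    (hN' : N ^ (d - 1) ≠ 0) {k : ℕ} (hk : k ≤ d) : finrank K (LinearMap.ker (N ^ k)) = k := by
  -- If two consecutive kernels agreed, the chain would be constant from there on, forcing `N ^ (d -
  -- 1) = 0`. Then `d` strict increases within dimension `d` leave exactly one dimension per step.
  have hlt : ∀ k < d, finrank K (LinearMap.ker (N ^ k)) < finrank K (LinearMap.ker (N ^ (k + 1))) := by
    intro k hk
    refine Submodule.finrank_lt_finrank_of_lt (lt_of_le_of_ne ?_ fun h => hN' ?_)
    · intro v hv
      rw [LinearMap.mem_ker] at hv ⊢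
      rw [pow_succ', Module.End.mul_apply, hv, map_zero]
    · have hst : ∀ j, ∀ v, (N ^ (k + j)) v = 0 → (N ^ k) v = 0 := by
        intro j
        induction j with
        | zero => exact fun v hv => hv
        | succ j ih =>
          intro v hv
          have : (N ^ j) v ∈ LinearMap.ker (N ^ (k + 1)) := by
            rw [LinearMap.mem_ker, ← Module.End.mul_apply, ← pow_add,
              show k + 1 + j = k + (j + 1) by ring, hv]
          rw [← h, LinearMap.mem_ker, ← Module.End.mul_apply, ← pow_add] at this
          exact ih v this
      ext v
      have h1 := hst (d - k) v (by rw [Nat.add_sub_cancel' hk.le, hN]; rfl)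
      rw [show d - 1 = (d - 1 - k) + k by omega, pow_add, Module.End.mul_apply, h1, map_zero]
      rfl
  have hge : ∀ k ≤ d, k ≤ finrank K (LinearMap.ker (N ^ k)) := by
    intro k
    induction k with
    | zero => simp
    | succ k ih => intro hk; have := hlt k hk; have := ih (by omega); omega
  have hle : ∀ j ≤ d, finrank K (LinearMap.ker (N ^ (d - j))) + j ≤ d := by
    intro j
    induction j with
    | zero => intro _; rw [add_zero]; exact (Submodule.finrank_le _).trans hV.le
    | succ j ih =>
      intro hj
      have h1 := hlt (d - (j + 1)) (by omega)
      rw [show d - (j + 1) + 1 = d - j by omega] at h1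
      have := ih (by omega)
      omega
  have h1 := hge k hk
  have h2 := hle (d - k) (by omega)
  rw [Nat.sub_sub_self hk] at h2
  omega

theorem range_pow_of_regular {V : Type*} [AddCommGroup V] [Module K V]
    [FiniteDimensional K V] {N : End K V} {d : ℕ} (hV : finrank K V = d) (hN : N ^ d = 0)
    (hN' : N ^ (d - 1) ≠ 0) {k : ℕ} (hk : k ≤ d) :
    LinearMap.range (N ^ (d - k)) = LinearMap.ker (N ^ k) := by
  refine Submodule.eq_of_le_of_finrank_eq ?_ ?_
  · rintro _ ⟨v, rfl⟩
    rw [LinearMap.mem_ker, ← Module.End.mul_apply, ← pow_add, Nat.add_sub_cancel' hk, hN]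
    rfl
  · have h1 := LinearMap.finrank_range_add_finrank_ker (N ^ (d - k))
    rw [finrank_ker_pow_of_regular hV hN hN' (Nat.sub_le d k)] at h1
    rw [finrank_ker_pow_of_regular hV hN hN' hk]
    omega

/-- The kernel of `N ^ k`, for `N` regular nilpotent, is invariant under `g` if and only if
`N ^ k * g * N ^ (d - k) = 0`. -/
theorem ker_pow_le_comap_iff {V : Type*} [AddCommGroup V] [Module K V]
    [FiniteDimensional K V] {N : End K V} {d : ℕ} (hV : finrank K V = d) (hN : N ^ d = 0)
    (hN' : N ^ (d - 1) ≠ 0) {k : ℕ} (hk : k ≤ d) (g : End K V) :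
    LinearMap.ker (N ^ k) ≤ (LinearMap.ker (N ^ k)).comap g ↔ N ^ k * g * N ^ (d - k) = 0 := by
  constructor
  · intro h
    ext v
    have : (N ^ (d - k)) v ∈ LinearMap.ker (N ^ k) := by
      rw [← range_pow_of_regular hV hN hN' hk]; exact ⟨v, rfl⟩
    exact h this
  · intro h v hv
    rw [← range_pow_of_regular hV hN hN' hk] at hv
    obtain ⟨w, rfl⟩ := hv
    exact LinearMap.congr_fun h w

/-- The only subspaces invariant under a regular nilpotent `N` are the kernels of its powers. -/
theorem eq_ker_pow_of_regular {V : Type*} [AddCommGroup V] [Module K V]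
    [FiniteDimensional K V] {N : End K V} {d : ℕ} (hV : finrank K V = d) (hN : N ^ d = 0)
    (hN' : N ^ (d - 1) ≠ 0) {r : Submodule K V} (hr : r ≤ r.comap N) :
    r = LinearMap.ker (N ^ finrank K r) := by
  have hnil : IsNilpotent (N.restrict hr) := by
    refine ⟨d, ?_⟩
    rw [Module.End.pow_restrict]
    ext v
    simp [hN]
  -- Cayley–Hamilton on `r` puts `r` inside a kernel of the same dimension.
  have h0 : (N.restrict hr) ^ finrank K r = 0 := by
    have := (N.restrict hr).aeval_self_charpoly
    rwa [hnil.charpoly_eq_X_pow_finrank, map_pow, aeval_X] at this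
  have hle : finrank K r ≤ d := hV ▸ Submodule.finrank_le r
  refine Submodule.eq_of_le_of_finrank_eq ?_ (finrank_ker_pow_of_regular hV hN hN' hle).symm
  intro v hv
  have := LinearMap.congr_fun h0 ⟨v, hv⟩
  rw [Module.End.pow_restrict] at this
  simpa using congrArg Subtype.val this

end Flags

/-! ### Unipotent representations as conjugates of triangular tuples. -/

section Representations

variable {n d : ℕ}

/-- The linear representation on `ℂ ^ d` given by a homomorphism to `GL(d, ℂ)`. -/
noncomputable def asRepresentation (ρ : Rep n d) :
    Representation ℂ (FreeGroup (Fin n)) (Fin d → ℂ) :=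
  (Matrix.toLinAlgEquiv' : Matrix (Fin d) (Fin d) ℂ ≃ₐ[ℂ] _).toMonoidHom.comp
    ((Units.coeHom _).comp ρ)

theorem asRepresentation_apply (ρ : Rep n d) (g : FreeGroup (Fin n)) :
    asRepresentation ρ g = Matrix.toLinAlgEquiv' (ρ g : Matrix (Fin d) (Fin d) ℂ) := rfl

theorem asRepresentation_sub_one (ρ : Rep n d) (g : FreeGroup (Fin n)) :
    asRepresentation ρ g - 1 =
      Matrix.toLinAlgEquiv' ((ρ g : Matrix (Fin d) (Fin d) ℂ) - 1) := by
  rw [asRepresentation_apply, map_sub, map_one]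

/-- Cayley–Hamilton in one direction; in the other, a nilpotent matrix has characteristic polynomial
`X ^ d`, which is then translated by one. This form makes unipotency a polynomial matrix equation.
-/
theorem mem_unipotents_iff_pow_eq_zero {g : Matrix.GeneralLinearGroup (Fin d) ℂ} :
    g ∈ unipotents d ↔ ((g : Matrix (Fin d) (Fin d) ℂ) - 1) ^ d = 0 := by
  constructor
  · intro h
    have h1 := Matrix.aeval_self_charpoly (g : Matrix (Fin d) (Fin d) ℂ)
    have h2 : (g : Matrix (Fin d) (Fin d) ℂ).charpoly = (X - 1) ^ d := h
    rw [h2] at h1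
    simpa using h1
  · intro h
    set M := (g : Matrix (Fin d) (Fin d) ℂ) with hM
    have h1 : (M - 1).charpoly = X ^ d := by
      have := (Matrix.isNilpotent_charpoly_sub_pow_of_isNilpotent ⟨d, h⟩).eq_zero
      rwa [Fintype.card_fin, sub_eq_zero] at this
    have h2 := Matrix.charpoly_sub_scalar (M - 1) (-1 : ℂ)
    rw [h1] at h2
    have h3 : M - 1 - Matrix.scalar (Fin d) (-1 : ℂ) = M := by
      rw [map_neg, map_one]; abel
    rw [h3] at h2
    show M.charpoly = _
    rw [h2]
    simp [sub_eq_add_neg]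

theorem mem_unipotents_iff_isNilpotent {ρ : Rep n d} {g : FreeGroup (Fin n)} :
    ρ g ∈ unipotents d ↔ IsNilpotent (asRepresentation ρ g - 1) := by
  rw [mem_unipotents_iff_pow_eq_zero, asRepresentation_sub_one]
  constructor
  · intro h
    exact ⟨d, by rw [← map_pow, h, map_zero]⟩
  · intro h
    have := h.charpoly_eq_X_pow_finrank
    have h2 := (Matrix.toLinAlgEquiv' ((ρ g : Matrix (Fin d) (Fin d) ℂ) - 1)).aeval_self_charpoly
    rw [this, map_pow, aeval_X, Module.finrank_fin_fun, ← map_pow] at h2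
    exact (map_eq_zero_iff _ Matrix.toLinAlgEquiv'.injective).1 h2

/-- The matrices with zeros on and above the diagonal. -/
def strictLower (d : ℕ) : Submodule ℂ (Matrix (Fin d) (Fin d) ℂ) where
  carrier := {T | ∀ i j, i ≤ j → T i j = 0}
  zero_mem' := fun _ _ _ => rfl
  add_mem' := fun ha hb i j h => by rw [Matrix.add_apply, ha i j h, hb i j h, add_zero]
  smul_mem' := fun c _ ha i j h => by rw [Matrix.smul_apply, ha i j h, smul_zero]

theorem det_one_add_of_mem_strictLower {T : Matrix (Fin d) (Fin d) ℂ} (hT : T ∈ strictLower d) :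
    (1 + T).det = 1 := by
  rw [Matrix.det_of_isLowerTriangular]
  · refine Finset.prod_eq_one fun i _ => ?_
    rw [Matrix.add_apply, Matrix.one_apply_eq, hT i i le_rfl, add_zero]
  · intro i j hij
    have hij' : i < j := hij
    rw [Matrix.add_apply, Matrix.one_apply_ne hij'.ne, hT i j hij'.le, add_zero]

theorem mem_unipotentReps_of_conj {ρ : Rep n d} {P : Matrix (Fin d) (Fin d) ℂ}
    (hP : IsUnit P.det) {T : Fin n → Matrix (Fin d) (Fin d) ℂ} (hT : ∀ i, T i ∈ strictLower d)
    (h : ∀ i, (ρ (FreeGroup.of i) : Matrix (Fin d) (Fin d) ℂ) * P = P * (1 + T i)) :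
    ρ ∈ unipotentReps n d := by
  intro g
  rw [mem_unipotents_iff_isNilpotent]
  -- `F j` is spanned by the last `j` columns of `P`; a strictly lower triangular matrix moves `F (j
  -- + 1)` into `F j`.
  let F : ℕ → Submodule ℂ (Fin d → ℂ) := fun j =>
    { carrier := {w | ∀ i : Fin d, (i : ℕ) + j < d → (P⁻¹.mulVec w) i = 0}
      zero_mem' := fun i _ => by simp
      add_mem' := fun ha hb i hi => by
        rw [Matrix.mulVec_add, Pi.add_apply, ha i hi, hb i hi, add_zero]
      smul_mem' := fun c _ ha i hi => by
        rw [Matrix.mulVec_smul, Pi.smul_apply, ha i hi, smul_zero] }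
  refine ⟨d, sub_one_pow_eq_zero_of_filtration (asRepresentation ρ) F ?_ ?_ ?_ ?_ g⟩
  · exact fun j k hjk w hw i hi => hw i (by omega)
  · rw [eq_bot_iff]
    intro w hw
    have h0 : P⁻¹.mulVec w = 0 := funext fun i => hw i (by simp)
    have h1 := congrArg P.mulVec h0
    rw [Matrix.mulVec_mulVec, Matrix.mul_nonsing_inv _ hP, Matrix.one_mulVec,
      Matrix.mulVec_zero] at h1
    exact h1
  · rw [eq_top_iff]
    exact fun w _ i hi => by omega
  · intro i j w hw a ha
    have h1 : P⁻¹.mulVec (asRepresentation ρ (FreeGroup.of i) w - w) =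
        (T i).mulVec (P⁻¹.mulVec w) := by
      have h2 : (ρ (FreeGroup.of i) : Matrix (Fin d) (Fin d) ℂ) = P * (1 + T i) * P⁻¹ := by
        rw [← h i, Matrix.mul_assoc, Matrix.mul_nonsing_inv _ hP, Matrix.mul_one]
      rw [asRepresentation_apply, Matrix.toLinAlgEquiv'_apply, h2, Matrix.mulVec_sub,
        Matrix.mulVec_mulVec, ← Matrix.mul_assoc, ← Matrix.mul_assoc,
        Matrix.nonsing_inv_mul _ hP, Matrix.one_mul, Matrix.add_mul, Matrix.one_mul,
        Matrix.add_mulVec, add_sub_cancel_left, Matrix.mulVec_mulVec]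
    rw [h1, Matrix.mulVec, dotProduct]
    refine Finset.sum_eq_zero fun b _ => ?_
    rcases le_or_gt a b with hab | hab
    · rw [hT i a b hab, zero_mul]
    · rw [hw b (by have : (b : ℕ) < a := hab; omega), mul_zero]

theorem exists_conj_of_mem_unipotentReps {ρ : Rep n d} (hρ : ρ ∈ unipotentReps n d) :
    ∃ (P : Matrix (Fin d) (Fin d) ℂ) (T : Fin n → Matrix (Fin d) (Fin d) ℂ), IsUnit P.det ∧
      (∀ i, T i ∈ strictLower d) ∧
      ∀ i, (ρ (FreeGroup.of i) : Matrix (Fin d) (Fin d) ℂ) * P = P * (1 + T i) := by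
  obtain ⟨b', hb'⟩ := exists_basis_of_isNilpotent_sub_one (asRepresentation ρ)
    (fun g => mem_unipotents_iff_isNilpotent.1 (hρ g)) d ⊤ (fun g => le_top) (by simp)
  let b : Module.Basis (Fin d) ℂ (Fin d → ℂ) := b'.map Submodule.topEquiv
  have hb : ∀ g j, asRepresentation ρ g (b j) - b j ∈ Submodule.span ℂ (b '' Set.Ioi j) := hb'
  let e := Pi.basisFun ℂ (Fin d)
  refine ⟨e.toMatrix b, fun i => LinearMap.toMatrix b b (asRepresentation ρ (FreeGroup.of i) - 1),
    ?_, ?_, ?_⟩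
  · have := e.toMatrix_mul_toMatrix_flip b
    exact (Matrix.isUnit_iff_isUnit_det _).1 (IsUnit.of_mul_eq_one _ this)
  · intro i j k hjk
    show LinearMap.toMatrix b b (asRepresentation ρ (FreeGroup.of i) - 1) j k = 0
    rw [LinearMap.toMatrix_apply]
    have h1 := (b.mem_span_image).1 (hb (FreeGroup.of i) k)
    by_contra hne
    exact absurd (h1 (Finsupp.mem_support_iff.2 hne)) (by simpa using hjk)
  · intro i
    have h1 : (ρ (FreeGroup.of i) : Matrix (Fin d) (Fin d) ℂ) =
        LinearMap.toMatrix e e (asRepresentation ρ (FreeGroup.of i)) := by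
      rw [asRepresentation_apply]
      exact (LinearMap.toMatrix'_toLin' _).symm
    show _ = e.toMatrix b *
      (1 + LinearMap.toMatrix b b (asRepresentation ρ (FreeGroup.of i) - 1))
    rw [h1, map_sub, LinearMap.toMatrix_one, add_sub_cancel,
      linearMap_toMatrix_mul_basis_toMatrix, basis_toMatrix_mul_linearMap_toMatrix]

/-- Every tuple of strictly lower triangular matrices and every change of basis give a
representation by unipotents. -/
theorem exists_mem_unipotentReps {P : Matrix (Fin d) (Fin d) ℂ} (hP : IsUnit P.det)
    {T : Fin n → Matrix (Fin d) (Fin d) ℂ} (hT : ∀ i, T i ∈ strictLower d) :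
    ∃ ρ ∈ unipotentReps n d,
      ∀ i, (ρ (FreeGroup.of i) : Matrix (Fin d) (Fin d) ℂ) = P * (1 + T i) * P⁻¹ := by
  let u : Fin n → Matrix.GeneralLinearGroup (Fin d) ℂ := fun i =>
    Matrix.GeneralLinearGroup.mkOfDetNeZero (P * (1 + T i) * P⁻¹) (by
      rw [Matrix.det_mul, Matrix.det_mul, det_one_add_of_mem_strictLower (hT i), mul_one,
        ← Matrix.det_mul, Matrix.mul_nonsing_inv _ hP, Matrix.det_one]
      exact one_ne_zero)
  have hu : ∀ i, (FreeGroup.lift u (FreeGroup.of i) : Matrix (Fin d) (Fin d) ℂ) =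
      P * (1 + T i) * P⁻¹ := by
    intro i
    rw [FreeGroup.lift_apply_of]
    rfl
  refine ⟨FreeGroup.lift u, mem_unipotentReps_of_conj hP hT fun i => ?_, hu⟩
  rw [hu, Matrix.mul_assoc, Matrix.nonsing_inv_mul _ hP, Matrix.mul_one]

end Representations

/-! ### Zariski closed sets given by matrix equations. -/

section Topology

open scoped Topology

variable {n d : ℕ}

theorem isClosed_zariski_iff {σ : Type} {Z : Set (σ → ℂ)} :
    IsClosed[zariski σ] Z ↔ ∃ S, Z = zeros S := by
  rw [← @isOpen_compl_iff _ _ (zariski σ)]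
  show Zᶜᶜ ∈ _ ↔ _
  rw [compl_compl]
  rfl

theorem isClosed_repZariski_iff {Z : Set (Rep n d)} :
    IsClosed[repZariski n d] Z ↔ ∃ S, Z = coords n d ⁻¹' zeros S := by
  let _ := zariski (Fin n × Fin d × Fin d)
  rw [isClosed_induced_iff]
  constructor
  · rintro ⟨t, ht, rfl⟩
    obtain ⟨S, rfl⟩ := isClosed_zariski_iff.1 ht
    exact ⟨S, rfl⟩
  · rintro ⟨S, rfl⟩
    exact ⟨_, isClosed_zariski_iff.2 ⟨S, rfl⟩, rfl⟩

variable (n d) in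
/-- The matrix-valued functions on the representation variety whose entries are polynomials in the
entries of the matrices of the generators. -/
noncomputable def polynomialMaps : Subring (Rep n d → Matrix (Fin d) (Fin d) ℂ) :=
  (RingHom.range (RingHom.pi fun ρ => (MvPolynomial.eval (coords n d ρ)).mapMatrix))

theorem of_mem_polynomialMaps (i : Fin n) :
    (fun ρ => (ρ (FreeGroup.of i) : Matrix (Fin d) (Fin d) ℂ)) ∈ polynomialMaps n d := by
  refine ⟨Matrix.of fun a b => MvPolynomial.X (i, a, b), ?_⟩
  funext ρ
  ext a b
  exact MvPolynomial.eval_X _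

theorem isClosed_eq_zero {f : Rep n d → Matrix (Fin d) (Fin d) ℂ} (hf : f ∈ polynomialMaps n d) :
    IsClosed[repZariski n d] {ρ | f ρ = 0} := by
  obtain ⟨Q, rfl⟩ := hf
  refine isClosed_repZariski_iff.2 ⟨{q | ∃ a b, q = Q a b}, ?_⟩
  ext ρ
  constructor
  · rintro h _ ⟨a, b, rfl⟩
    exact congrFun (congrFun h a) b
  · intro h
    ext a b
    exact h _ ⟨a, b, rfl⟩

theorem ZariskiIrreducible.exists_subset {V : Set (Rep n d)} (hV : ZariskiIrreducible V)
    {ι : Type*} (t : Finset ι) (Z : ι → Set (Rep n d))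
    (hZ : ∀ i ∈ t, IsClosed[repZariski n d] (Z i)) (h : ∀ ρ ∈ V, ∃ i ∈ t, ρ ∈ Z i) :
    ∃ i ∈ t, V ⊆ Z i := by
  classical
  let _ := repZariski n d
  obtain ⟨z, hz, hVz⟩ := isIrreducible_iff_sUnion_isClosed.1 hV (t.image Z)
    (by simpa using hZ) (by
      intro ρ hρ
      obtain ⟨i, hi, hρi⟩ := h ρ hρ
      exact ⟨Z i, by simpa using ⟨i, hi, rfl⟩, hρi⟩)
  obtain ⟨i, hi, rfl⟩ := Finset.mem_image.1 hz
  exact ⟨i, hi, hVz⟩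

end Topology

/-! ### Primitive elements from transvections. -/

section FreeGroups

variable {m : ℕ}

theorem apply_of_mem_primitives {n : ℕ} (φ : FreeGroup (Fin n) ≃* FreeGroup (Fin n)) (i : Fin n) :
    φ (FreeGroup.of i) ∈ primitives n :=
  ⟨(FreeGroupBasis.ofFreeGroup (Fin n)).map φ, i, by simp⟩

theorem of_mem_primitives {n : ℕ} (i : Fin n) : FreeGroup.of i ∈ primitives n :=
  apply_of_mem_primitives (MulEquiv.refl _) i

theorem comp_mem_primitiveUnipotentReps {n d : ℕ} {ρ : Rep n d}
    (hρ : ρ ∈ primitiveUnipotentReps n d) (φ : FreeGroup (Fin n) ≃* FreeGroup (Fin n)) :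
    ρ.comp φ.toMonoidHom ∈ primitiveUnipotentReps n d := by
  rintro _ ⟨b, i, rfl⟩
  exact hρ _ ⟨b.map φ, i, by simp⟩

/-- The inclusion of the free group on all the generators but the first. -/
def tailHom (m : ℕ) : FreeGroup (Fin m) →* FreeGroup (Fin (m + 1)) := FreeGroup.map Fin.succ

/-- The endomorphism of the free group that multiplies the first generator by a word `h` in the
other ones, and fixes these. -/
def transvectionHom (h : FreeGroup (Fin m)) :
    FreeGroup (Fin (m + 1)) →* FreeGroup (Fin (m + 1)) :=
  FreeGroup.lift (Fin.cons (FreeGroup.of 0 * tailHom m h) fun i => FreeGroup.of i.succ)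

theorem transvectionHom_zero (h : FreeGroup (Fin m)) :
    transvectionHom h (FreeGroup.of 0) = FreeGroup.of 0 * tailHom m h := by
  simp [transvectionHom]

theorem transvectionHom_succ (h : FreeGroup (Fin m)) (i : Fin m) :
    transvectionHom h (FreeGroup.of i.succ) = FreeGroup.of i.succ := by
  simp [transvectionHom]

theorem transvectionHom_tailHom (h x : FreeGroup (Fin m)) :
    transvectionHom h (tailHom m x) = tailHom m x := by
  have : (transvectionHom h).comp (tailHom m) = tailHom m := by
    ext i
    simp [tailHom, transvectionHom_succ]
  exact DFunLike.congr_fun this x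

theorem transvectionHom_comp (h k : FreeGroup (Fin m)) (hk : h * k = 1) :
    (transvectionHom h).comp (transvectionHom k) = MonoidHom.id _ := by
  ext i
  refine Fin.cases ?_ (fun i => ?_) i
  · rw [MonoidHom.comp_apply, transvectionHom_zero, map_mul, transvectionHom_zero,
      transvectionHom_tailHom, mul_assoc, ← map_mul, hk, map_one, mul_one, MonoidHom.id_apply]
  · rw [MonoidHom.comp_apply, transvectionHom_succ, transvectionHom_succ, MonoidHom.id_apply]

/-- The word is the image of the first generator under a transvection, whose inverse is the
transvection by `h⁻¹`. This provides the coset on which the trace is constant. -/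
theorem of_zero_mul_tailHom_mem_primitives (h : FreeGroup (Fin m)) :
    FreeGroup.of 0 * tailHom m h ∈ primitives (m + 1) := by
  rw [← transvectionHom_zero]
  exact apply_of_mem_primitives (MonoidHom.toMulEquiv (transvectionHom h) (transvectionHom h⁻¹)
    (transvectionHom_comp _ _ (inv_mul_cancel h)) (transvectionHom_comp _ _ (mul_inv_cancel h))) 0

end FreeGroups

/-! ### Irreducibility forces equality. -/

section EqualityOfIrreducible

open scoped Topology

variable {n m d : ℕ}

theorem unipotentReps_subset : unipotentReps n d ⊆ primitiveUnipotentReps n d :=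
  fun _ hρ p _ => hρ p

/-- On `𝒫𝒰(n, d)` the matrix of every word is a polynomial in the matrices of the generators. -/
theorem exists_polynomialMap (x : FreeGroup (Fin n)) :
    ∃ f ∈ polynomialMaps n d, ∀ ρ ∈ primitiveUnipotentReps n d,
      (ρ x : Matrix (Fin d) (Fin d) ℂ) = f ρ := by
  induction x using FreeGroup.induction_on with
  | C1 => exact ⟨1, one_mem _, fun ρ _ => by simp⟩
  | of i => exact ⟨_, of_mem_polynomialMaps i, fun _ _ => rfl⟩
  | inv_of i =>
    -- The inverse of a unipotent `u` is the finite geometric sum of the powers `(1 - u) ^ j`, `j <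
    -- d`.
    refine ⟨_, sum_mem fun j (_ : j ∈ Finset.range d) =>
      pow_mem (sub_mem (one_mem _) (of_mem_polynomialMaps i)) j, fun ρ hρ => ?_⟩
    have h1 := mem_unipotents_iff_pow_eq_zero.1 (hρ _ (of_mem_primitives i))
    have h2 := geom_sum_mul_neg (1 - (ρ (FreeGroup.of i) : Matrix (Fin d) (Fin d) ℂ)) d
    rw [sub_sub_cancel, ← neg_sub, neg_pow, h1, mul_zero, sub_zero, neg_sub] at h2
    rw [map_inv, Matrix.coe_units_inv, Matrix.inv_eq_left_inv h2]
    simp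
  | mul x y hx hy =>
    obtain ⟨f, hf, hfx⟩ := hx
    obtain ⟨g, hg, hgy⟩ := hy
    exact ⟨f * g, mul_mem hf hg, fun ρ hρ => by
      rw [map_mul, Units.val_mul, hfx ρ hρ, hgy ρ hρ]; rfl⟩

/-- The nilpotent part of the second generator. -/
def nilpotentPart (ρ : Rep (m + 3) d) : Matrix (Fin d) (Fin d) ℂ :=
  (ρ (FreeGroup.of 1) : Matrix (Fin d) (Fin d) ℂ) - 1

theorem nilpotentPart_mem_polynomialMaps :
    (fun ρ : Rep (m + 3) d => nilpotentPart ρ) ∈ polynomialMaps (m + 3) d :=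
  sub_mem (of_mem_polynomialMaps 1) (one_mem _)

/-- When the nilpotent part of the second generator is regular, these are the representations for
which the kernel of its `k`-th power is invariant under the `i`-th generator. -/
def invariantLocus (m d k : ℕ) (i : Fin (m + 3)) : Set (Rep (m + 3) d) :=
  {ρ | nilpotentPart ρ ^ k * (ρ (FreeGroup.of i) : Matrix (Fin d) (Fin d) ℂ) *
    nilpotentPart ρ ^ (d - k) = 0}

theorem isClosed_invariantLocus (k : ℕ) (i : Fin (m + 3)) :
    IsClosed[repZariski (m + 3) d] (invariantLocus m d k i) :=
  isClosed_eq_zero (mul_mem (mul_mem (pow_mem nilpotentPart_mem_polynomialMaps k)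
    (of_mem_polynomialMaps i)) (pow_mem nilpotentPart_mem_polynomialMaps (d - k)))

theorem nilpotentPart_pow {ρ : Rep (m + 3) d} (hρ : ρ ∈ primitiveUnipotentReps (m + 3) d) :
    nilpotentPart ρ ^ d = 0 :=
  mem_unipotents_iff_pow_eq_zero.1 (hρ _ (of_mem_primitives 1))

/-- Sending every generator to one full Jordan block works; this keeps the non-regular locus from
being all of `𝒫𝒰`. -/
theorem exists_regular (hd : 0 < d) :
    ∃ ρ ∈ primitiveUnipotentReps (m + 3) d, nilpotentPart ρ ^ (d - 1) ≠ 0 := by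
  let T : Matrix (Fin d) (Fin d) ℂ := Matrix.of fun i j => if (i : ℕ) = j + 1 then 1 else 0
  have hT : T ∈ strictLower d := fun i j hij => by
    have : ¬ (i : ℕ) = j + 1 := by have : (i : ℕ) ≤ j := hij; omega
    simp [T, this]
  obtain ⟨ρ, hρ, h⟩ := exists_mem_unipotentReps (n := m + 3) (P := 1) (by simp) (fun _ => hT)
  refine ⟨ρ, unipotentReps_subset hρ, fun h0 => ?_⟩
  have hN : nilpotentPart ρ = T := by simp [nilpotentPart, h]
  have hpow : ∀ k (hk : k < d), (T ^ k).mulVec (Pi.single ⟨0, hd⟩ 1) = Pi.single ⟨k, hk⟩ 1 := by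
    intro k
    induction k with
    | zero => exact fun _ => by rw [pow_zero, Matrix.one_mulVec]
    | succ k ih =>
      intro hk
      rw [pow_succ', ← Matrix.mulVec_mulVec, ih (by omega), Matrix.mulVec_single_one]
      ext i
      simp [T, Pi.single_apply, Fin.ext_iff]
  have := hpow (d - 1) (by omega)
  rw [← hN, h0, Matrix.zero_mulVec] at this
  simpa using congrFun this ⟨d - 1, by omega⟩

theorem mem_invariantLocus_iff {ρ : Rep (m + 3) d} (hρ : ρ ∈ primitiveUnipotentReps (m + 3) d)
    (hreg : nilpotentPart ρ ^ (d - 1) ≠ 0) {k : ℕ} (hk : k ≤ d) (i : Fin (m + 3)) :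
    ρ ∈ invariantLocus m d k i ↔
      LinearMap.ker (Matrix.toLinAlgEquiv' (nilpotentPart ρ) ^ k) ≤
        (LinearMap.ker (Matrix.toLinAlgEquiv' (nilpotentPart ρ) ^ k)).comap
          (asRepresentation ρ (FreeGroup.of i)) := by
  rw [ker_pow_le_comap_iff (d := d) (by simp) (by rw [← map_pow, nilpotentPart_pow hρ, map_zero])
    (by rwa [← map_pow, Ne, map_eq_zero_iff _ Matrix.toLinAlgEquiv'.injective]) hk,
    asRepresentation_apply, ← map_pow, ← map_pow, ← map_mul, ← map_mul,
    map_eq_zero_iff _ Matrix.toLinAlgEquiv'.injective]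
  rfl

/-- The refinement of a gap in the invariant flag by a subspace invariant under all generators
but the first. -/
theorem exists_mem_invariantLocus {ρ : Rep (m + 3) d}
    (hρ : ρ ∈ primitiveUnipotentReps (m + 3) d) (hreg : nilpotentPart ρ ^ (d - 1) ≠ 0)
    {k l : ℕ} (hkl : k + 2 ≤ l) (hl : l ≤ d) (hk' : ∀ i, ρ ∈ invariantLocus m d k i)
    (hl' : ∀ i, ρ ∈ invariantLocus m d l i) :
    ∃ j, k < j ∧ j < l ∧ ∀ i : Fin (m + 2), ρ ∈ invariantLocus m d j i.succ := by
  set N := (Matrix.toLinAlgEquiv' (nilpotentPart ρ) : Module.End ℂ (Fin d → ℂ)) with hNdef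
  have hV : Module.finrank ℂ (Fin d → ℂ) = d := by simp
  have hN : N ^ d = 0 := by rw [hNdef, ← map_pow, nilpotentPart_pow hρ, map_zero]
  have hN' : N ^ (d - 1) ≠ 0 := by
    rwa [hNdef, ← map_pow, Ne, map_eq_zero_iff _ Matrix.toLinAlgEquiv'.injective]
  have hfin : ∀ k ≤ d, Module.finrank ℂ (LinearMap.ker (N ^ k)) = k :=
    fun k hk => finrank_ker_pow_of_regular hV hN hN' hk
  have hmono : LinearMap.ker (N ^ k) ≤ LinearMap.ker (N ^ l) := by
    intro v hv
    rw [LinearMap.mem_ker] at hv ⊢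
    rw [show l = (l - k) + k by omega, pow_add, Module.End.mul_apply, hv, map_zero]
  obtain ⟨r, hkr, hrl, hr⟩ := exists_invariant_between (asRepresentation ρ) (tailHom (m + 2))
    (FreeGroup.of 0) (fun h => mem_unipotents_iff_isNilpotent.1
      (hρ _ (of_zero_mul_tailHom_mem_primitives h))) _ _ hmono
    (le_comap_of_forall_of _ _ fun i => (mem_invariantLocus_iff hρ hreg (by omega) i).1 (hk' i))
    (le_comap_of_forall_of _ _ fun i => (mem_invariantLocus_iff hρ hreg hl i).1 (hl' i))
    (by rw [hfin k (by omega), hfin l hl]; exact hkl)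
  have hr' : ∀ i : Fin (m + 2), r ≤ r.comap (asRepresentation ρ (FreeGroup.of i.succ)) :=
    fun i => by simpa [tailHom] using hr (FreeGroup.of i)
  -- The generator defining `N` is among those preserving `r`, so `r` must be a kernel of a power of
  -- `N`.
  have hrN : r ≤ r.comap N := by
    intro v hv
    have h1 : N = asRepresentation ρ (FreeGroup.of 1) - 1 := (asRepresentation_sub_one ρ _).symm
    rw [h1]
    exact r.sub_mem (hr' 0 hv) hv
  have hreq := eq_ker_pow_of_regular hV hN hN' hrN
  have h1 := Submodule.finrank_lt_finrank_of_lt hkr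
  have h2 := Submodule.finrank_lt_finrank_of_lt hrl
  rw [hfin k (by omega)] at h1
  rw [hfin l hl] at h2
  refine ⟨Module.finrank ℂ r, h1, h2, fun i => ?_⟩
  rw [mem_invariantLocus_iff hρ hreg (by omega), ← hNdef, ← hreq]
  exact hr' i

/-- `𝒫𝒰` is stable under automorphisms of the free group. The swap of generators 0 and 2 fixes
generator 1, hence `N`, and carries the condition for generator 2 to generator 0. A third generator
is indispensable here. -/
theorem subset_invariantLocus_of_succ {k : ℕ}
    (h : ∀ i : Fin (m + 2), primitiveUnipotentReps (m + 3) d ⊆ invariantLocus m d k i.succ)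
    (i : Fin (m + 3)) : primitiveUnipotentReps (m + 3) d ⊆ invariantLocus m d k i := by
  refine Fin.cases ?_ (fun i => h i) i
  intro ρ hρ
  let φ := FreeGroup.freeGroupCongr (Equiv.swap (0 : Fin (m + 3)) 2)
  have h0 : φ (FreeGroup.of 2) = FreeGroup.of 0 := by simp [φ]
  have h1 : φ (FreeGroup.of 1) = FreeGroup.of 1 := by
    simp only [φ, FreeGroup.freeGroupCongr_apply, FreeGroup.map.of]
    rw [Equiv.swap_apply_of_ne_of_ne] <;> simp [Fin.ext_iff, Nat.mod_eq_of_lt]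
  have h2 : (1 : Fin (m + 2)).succ = 2 := rfl
  have := h 1 (comp_mem_primitiveUnipotentReps hρ φ)
  rw [h2] at this
  simpa [invariantLocus, nilpotentPart, h0, h1] using this

/-- Strong induction on the length of a gap `k, l` in the flag: irreducibility selects one
intermediate dimension valid on all of `𝒫𝒰`, which splits the gap into two shorter ones. -/
theorem subset_invariantLocus
    (hirr : ZariskiIrreducible (primitiveUnipotentReps (m + 3) d)) (hd : 0 < d) {k : ℕ}
    (hk : k ≤ d) (i : Fin (m + 3)) :
    primitiveUnipotentReps (m + 3) d ⊆ invariantLocus m d k i := by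
  have key : ∀ g k l, l ≤ d → l = k + g →
      (∀ i, primitiveUnipotentReps (m + 3) d ⊆ invariantLocus m d k i) →
      (∀ i, primitiveUnipotentReps (m + 3) d ⊆ invariantLocus m d l i) →
      ∀ j, k ≤ j → j ≤ l → ∀ i, primitiveUnipotentReps (m + 3) d ⊆ invariantLocus m d j i := by
    intro g
    induction g using Nat.strong_induction_on with
    | _ g ih =>
      intro k l hl hg hk' hl' j hkj hjl
      rcases Nat.eq_or_lt_of_le hkj with rfl | hkj'
      · exact hk'
      rcases Nat.eq_or_lt_of_le hjl with rfl | hjl'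
      · exact hl'
      -- The index `k` is not an interior dimension, so its slot holds the non-regular locus.
      let Z : ℕ → Set (Rep (m + 3) d) := fun a =>
        if a = k then {ρ | nilpotentPart ρ ^ (d - 1) = 0}
        else ⋂ i : Fin (m + 2), invariantLocus m d a i.succ
      obtain ⟨a, ha, haZ⟩ := hirr.exists_subset (Finset.Ico k l) Z (by
        intro a _
        by_cases hak : a = k
        · simp only [Z, hak, if_true]
          exact isClosed_eq_zero (pow_mem nilpotentPart_mem_polynomialMaps _)
        · simp only [Z, hak, if_false]
          let _ := repZariski (m + 3) d
          exact isClosed_iInter fun i => isClosed_invariantLocus a i.succ) (by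
        intro ρ hρ
        by_cases hreg : nilpotentPart ρ ^ (d - 1) = 0
        · exact ⟨k, by simp; omega, by simpa [Z] using hreg⟩
        · obtain ⟨a, hka, hal, ha⟩ := exists_mem_invariantLocus hρ hreg (by omega) hl
            (fun i => hk' i hρ) (fun i => hl' i hρ)
          exact ⟨a, by simp; omega, by simpa [Z, hka.ne'] using ha⟩)
      rw [Finset.mem_Ico] at ha
      by_cases hak : a = k
      · obtain ⟨ρ, hρ, hreg⟩ := exists_regular (m := m) hd
        have := haZ hρ
        simp only [Z, hak, if_true] at this
        exact absurd this hreg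
      · simp only [Z, hak, if_false, Set.subset_iInter_iff] at haZ
        have ha' := subset_invariantLocus_of_succ haZ
        rcases le_total j a with hja | hja
        · exact ih (a - k) (by omega) k a (by omega) (by omega) hk' ha' j hkj hja
        · exact ih (l - a) (by omega) a l hl (by omega) ha' hl' j hja hjl
  -- The outer terms `0` and `d` satisfy the condition because `N ^ d = 0`.
  refine key d 0 d le_rfl (by omega) ?_ ?_ k (Nat.zero_le k) hk i
  · intro i ρ hρ
    simp [invariantLocus, nilpotentPart_pow hρ]
  · intro i ρ hρ
    simp [invariantLocus, nilpotentPart_pow hρ]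

/-- The kernels of the powers of `N` form a complete flag invariant under each generator; a
nilpotent `ρ(x_i) - 1` preserving it must lower it by one step. -/
theorem mem_unipotentReps_of_regular {ρ : Rep (m + 3) d}
    (hρ : ρ ∈ primitiveUnipotentReps (m + 3) d) (hreg : nilpotentPart ρ ^ (d - 1) ≠ 0)
    (h : ∀ k ≤ d, ∀ i, ρ ∈ invariantLocus m d k i) : ρ ∈ unipotentReps (m + 3) d := by
  intro g
  rw [mem_unipotents_iff_isNilpotent]
  set N := (Matrix.toLinAlgEquiv' (nilpotentPart ρ) : Module.End ℂ (Fin d → ℂ)) with hNdef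
  have hV : Module.finrank ℂ (Fin d → ℂ) = d := by simp
  have hN : N ^ d = 0 := by rw [hNdef, ← map_pow, nilpotentPart_pow hρ, map_zero]
  have hN' : N ^ (d - 1) ≠ 0 := by
    rwa [hNdef, ← map_pow, Ne, map_eq_zero_iff _ Matrix.toLinAlgEquiv'.injective]
  have hfin : ∀ k ≤ d, Module.finrank ℂ (LinearMap.ker (N ^ k)) = k :=
    fun k hk => finrank_ker_pow_of_regular hV hN hN' hk
  have hmono : Monotone fun k => LinearMap.ker (N ^ k) := by
    intro k l hkl v hv
    rw [LinearMap.mem_ker] at hv ⊢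
    rw [show l = (l - k) + k by omega, pow_add, Module.End.mul_apply, hv, map_zero]
  have htop : ∀ k, d ≤ k → LinearMap.ker (N ^ k) = ⊤ := by
    intro k hk
    rw [show k = d + (k - d) by omega, pow_add, hN, zero_mul, LinearMap.ker_zero]
  have hinv : ∀ k i, LinearMap.ker (N ^ k) ≤
      (LinearMap.ker (N ^ k)).comap (asRepresentation ρ (FreeGroup.of i)) := by
    intro k i
    rcases le_total k d with hk | hk
    · exact (mem_invariantLocus_iff hρ hreg hk i).1 (h k hk i)
    · rw [htop k hk]; exact le_top
  have hle : ∀ k i, (LinearMap.ker (N ^ k)).map (asRepresentation ρ (FreeGroup.of i) - 1) ≤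
      LinearMap.ker (N ^ k) := by
    rintro k i _ ⟨v, hv, rfl⟩
    exact Submodule.sub_mem _ (hinv k i hv) hv
  refine ⟨d, sub_one_pow_eq_zero_of_filtration _ (fun k => LinearMap.ker (N ^ k)) hmono ?_
    (htop d le_rfl) ?_ g⟩
  · simp [Module.End.one_eq_id]
  · intro i j v hv
    rcases lt_or_ge j d with hj | hj
    · exact map_le_of_isNilpotent (mem_unipotents_iff_isNilpotent.1 (hρ _ (of_mem_primitives i)))
        (hmono j.le_succ) (hle j i) (hle (j + 1) i) (by rw [hfin j hj.le, hfin (j + 1) hj])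
        ⟨v, hv, rfl⟩
    · rw [htop j hj]; trivial

/-- For each word `x`, `𝒫𝒰` is covered by the non-regular locus and the closed locus where `ρ x` is
unipotent, written through the polynomial map `f`. The first is not everything, so the second is. -/
theorem unipotentReps_eq_of_zariskiIrreducible
    (hirr : ZariskiIrreducible (primitiveUnipotentReps (m + 3) d)) :
    unipotentReps (m + 3) d = primitiveUnipotentReps (m + 3) d := by
  refine unipotentReps_subset.antisymm ?_
  rcases Nat.eq_zero_or_pos d with rfl | hd
  · intro ρ _ g
    rw [mem_unipotents_iff_pow_eq_zero]
    exact Subsingleton.elim _ _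
  suffices h : ∀ x, ∀ ρ ∈ primitiveUnipotentReps (m + 3) d, ρ x ∈ unipotents d from
    fun ρ hρ x => h x ρ hρ
  intro x
  obtain ⟨f, hf, hfx⟩ := exists_polynomialMap (n := m + 3) (d := d) x
  obtain ⟨b, -, hb⟩ := hirr.exists_subset Finset.univ
    (fun b : Bool => if b then {ρ | (f ρ - 1) ^ d = 0} else {ρ | nilpotentPart ρ ^ (d - 1) = 0})
    (by
      rintro (_ | _) _
      · exact isClosed_eq_zero (pow_mem nilpotentPart_mem_polynomialMaps _)
      · exact isClosed_eq_zero (pow_mem (sub_mem hf (one_mem _)) d))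
    (by
      intro ρ hρ
      by_cases hreg : nilpotentPart ρ ^ (d - 1) = 0
      · exact ⟨false, Finset.mem_univ _, hreg⟩
      · have := mem_unipotentReps_of_regular hρ hreg
          (fun k hk i => subset_invariantLocus hirr hd hk i hρ) x
        rw [mem_unipotents_iff_pow_eq_zero, hfx ρ hρ] at this
        exact ⟨true, Finset.mem_univ _, this⟩)
  cases b with
  | false =>
    obtain ⟨ρ, hρ, hreg⟩ := exists_regular (m := m) hd
    exact absurd (hb hρ) hreg
  | true =>
    intro ρ hρ
    rw [mem_unipotents_iff_pow_eq_zero, hfx ρ hρ]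
    exact hb hρ

end EqualityOfIrreducible

/-! ### Irreducibility of the unipotent representations. -/

section IrreducibleOfEquality

open scoped Topology

variable {n d : ℕ}

/-- The composite of a polynomial with a curve given by fractions with a common denominator is such
a fraction. -/
theorem exists_eval_mul_pow_eq {σ : Type*} (q : σ → ℂ[X]) (D : ℂ[X]) (f : MvPolynomial σ ℂ) :
    ∃ (r : ℂ[X]) (N : ℕ), ∀ t, D.eval t ≠ 0 →
      MvPolynomial.eval (fun e => (q e).eval t / D.eval t) f * D.eval t ^ N = r.eval t := by
  induction f using MvPolynomial.induction_on with
  | C a => exact ⟨C a, 0, fun t _ => by simp⟩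
  | add f g hf hg =>
    obtain ⟨r, N, hr⟩ := hf
    obtain ⟨s, M, hs⟩ := hg
    refine ⟨r * D ^ M + s * D ^ N, N + M, fun t ht => ?_⟩
    simp only [map_add, eval_add, eval_mul, eval_pow, ← hr t ht, ← hs t ht]
    ring
  | mul_X f e hf =>
    obtain ⟨r, N, hr⟩ := hf
    refine ⟨r * q e, N + 1, fun t ht => ?_⟩
    simp only [map_mul, MvPolynomial.eval_X, eval_mul, ← hr t ht]
    field_simp
    ring

/-- Two points of `𝒰(n, d)` lie on a rational curve in `𝒰(n, d)`. -/
theorem exists_curve {ρ₀ ρ₁ : Rep n d} (h₀ : ρ₀ ∈ unipotentReps n d)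
    (h₁ : ρ₁ ∈ unipotentReps n d) :
    ∃ (q : Fin n × Fin d × Fin d → ℂ[X]) (D : ℂ[X]), D.eval 0 ≠ 0 ∧ D.eval 1 ≠ 0 ∧
      (coords n d ρ₀ = fun e => (q e).eval 0 / D.eval 0) ∧
      (coords n d ρ₁ = fun e => (q e).eval 1 / D.eval 1) ∧
      ∀ t, D.eval t ≠ 0 → ∃ ρ ∈ unipotentReps n d,
        coords n d ρ = fun e => (q e).eval t / D.eval t := by
  obtain ⟨P₀, T₀, hP₀, hT₀, hc₀⟩ := exists_conj_of_mem_unipotentReps h₀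
  obtain ⟨P₁, T₁, hP₁, hT₁, hc₁⟩ := exists_conj_of_mem_unipotentReps h₁
  -- Change of basis and triangular parts are interpolated linearly; the curve is defined wherever
  -- the determinant of the interpolated basis matrix, nonzero at 0 and 1, does not vanish.
  let line : Matrix (Fin d) (Fin d) ℂ → Matrix (Fin d) (Fin d) ℂ → Matrix (Fin d) (Fin d) ℂ[X] :=
    fun A B => Matrix.of fun a b => C (A a b) + X * C (B a b - A a b)
  have hline : ∀ A B t, (evalRingHom t).mapMatrix (line A B) = A + t • (B - A) := by
    intro A B t
    ext a b
    simp [line]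
  let P := line P₀ P₁
  let T := fun i => line (T₀ i) (T₁ i)
  let Pt : ℂ → Matrix (Fin d) (Fin d) ℂ := fun t => P₀ + t • (P₁ - P₀)
  let Tt : ℂ → Fin n → Matrix (Fin d) (Fin d) ℂ := fun t i => T₀ i + t • (T₁ i - T₀ i)
  have hD : ∀ t, P.det.eval t = (Pt t).det := by
    intro t
    rw [← coe_evalRingHom, RingHom.map_det, hline]
  have hTt : ∀ t i, Tt t i ∈ strictLower d := fun t i =>
    (strictLower d).add_mem (hT₀ i) ((strictLower d).smul_mem t ((strictLower d).sub_mem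
      (hT₁ i) (hT₀ i)))
  have hq : ∀ t, P.det.eval t ≠ 0 → ∀ i a b,
      ((P * (1 + T i) * P.adjugate) a b).eval t / P.det.eval t =
        (Pt t * (1 + Tt t i) * (Pt t)⁻¹) a b := by
    intro t ht i a b
    have h1 : (evalRingHom t).mapMatrix (P * (1 + T i) * P.adjugate) =
        Pt t * (1 + Tt t i) * (Pt t).adjugate := by
      rw [map_mul, map_mul, map_add, map_one, hline, hline, RingHom.map_adjugate, hline]
    have h2 := congrFun (congrFun h1 a) b
    have h3 : ((P * (1 + T i) * P.adjugate) a b).eval t =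
        (Pt t * (1 + Tt t i) * (Pt t).adjugate) a b := h2
    rw [h3, Matrix.inv_def, Matrix.mul_smul, Matrix.smul_apply, hD, Ring.inverse_eq_inv',
      smul_eq_mul, div_eq_inv_mul]
  have hconj : ∀ (ρ : Rep n d) (A : Matrix (Fin d) (Fin d) ℂ) (B : Matrix (Fin d) (Fin d) ℂ) (i),
      IsUnit A.det → (ρ (FreeGroup.of i) : Matrix (Fin d) (Fin d) ℂ) * A = A * (1 + B) →
      (ρ (FreeGroup.of i) : Matrix (Fin d) (Fin d) ℂ) = A * (1 + B) * A⁻¹ := by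
    intro ρ A B i hA h
    rw [← h, Matrix.mul_assoc, Matrix.mul_nonsing_inv _ hA, Matrix.mul_one]
  have hPt0 : Pt 0 = P₀ := by simp [Pt]
  have hPt1 : Pt 1 = P₁ := by simp [Pt]
  have hTt0 : Tt 0 = T₀ := by funext i; simp [Tt]
  have hTt1 : Tt 1 = T₁ := by funext i; simp [Tt]
  have hD0 : P.det.eval 0 ≠ 0 := by rw [hD, hPt0]; exact hP₀.ne_zero
  have hD1 : P.det.eval 1 ≠ 0 := by rw [hD, hPt1]; exact hP₁.ne_zero
  refine ⟨fun e => (P * (1 + T e.1) * P.adjugate) e.2.1 e.2.2, P.det, hD0, hD1, ?_, ?_, ?_⟩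
  · funext e
    rw [hq 0 hD0, hPt0, hTt0, ← hconj ρ₀ P₀ (T₀ e.1) e.1 hP₀ (hc₀ e.1)]
    rfl
  · funext e
    rw [hq 1 hD1, hPt1, hTt1, ← hconj ρ₁ P₁ (T₁ e.1) e.1 hP₁ (hc₁ e.1)]
    rfl
  · intro t ht
    obtain ⟨ρ, hρ, h⟩ := exists_mem_unipotentReps (P := Pt t)
      (isUnit_iff_ne_zero.2 (hD t ▸ ht)) (hTt t)
    refine ⟨ρ, hρ, ?_⟩
    funext e
    rw [hq t ht, ← h]
    rfl

/-- If neither closed set contains `𝒰`, some `f₀` and `f₁` from their equations are nonzero at two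
points `ρ₀` and `ρ₁`. Along the curve joining these, both become nonzero rational functions of `t`,
so at some `t` neither vanishes, giving a point outside both sets. -/
theorem zariskiIrreducible_unipotentReps (n d : ℕ) : ZariskiIrreducible (unipotentReps n d) := by
  let _ := repZariski n d
  refine ⟨⟨1, fun g => mem_unipotents_iff_pow_eq_zero.2 ?_⟩, ?_⟩
  · rcases Nat.eq_zero_or_pos d with rfl | hd
    · exact Subsingleton.elim _ _
    · simp [hd.ne']
  rw [isPreirreducible_iff_isClosed_union_isClosed]
  intro z₀ z₁ hz₀ hz₁ hcov
  by_contra! hcon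
  obtain ⟨S₀, rfl⟩ := isClosed_repZariski_iff.1 hz₀
  obtain ⟨S₁, rfl⟩ := isClosed_repZariski_iff.1 hz₁
  obtain ⟨ρ₀, hρ₀, hn₀⟩ := Set.not_subset.1 hcon.1
  obtain ⟨ρ₁, hρ₁, hn₁⟩ := Set.not_subset.1 hcon.2
  have hn₀' : ¬ ∀ f ∈ S₀, MvPolynomial.eval (coords n d ρ₀) f = 0 := hn₀
  have hn₁' : ¬ ∀ f ∈ S₁, MvPolynomial.eval (coords n d ρ₁) f = 0 := hn₁
  push Not at hn₀' hn₁'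
  obtain ⟨f₀, hf₀, hne₀⟩ := hn₀'
  obtain ⟨f₁, hf₁, hne₁⟩ := hn₁'
  obtain ⟨q, D, hD0, hD1, hc₀, hc₁, hcurve⟩ := exists_curve hρ₀ hρ₁
  obtain ⟨r₀, N₀, hr₀⟩ := exists_eval_mul_pow_eq q D f₀
  obtain ⟨r₁, N₁, hr₁⟩ := exists_eval_mul_pow_eq q D f₁
  have hr₀' : r₀ ≠ 0 := by
    rintro rfl
    have := hr₀ 0 hD0
    rw [← hc₀, eval_zero] at this
    exact mul_ne_zero hne₀ (pow_ne_zero _ hD0) this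
  have hr₁' : r₁ ≠ 0 := by
    rintro rfl
    have := hr₁ 1 hD1
    rw [← hc₁, eval_zero] at this
    exact mul_ne_zero hne₁ (pow_ne_zero _ hD1) this
  have hD' : D ≠ 0 := by rintro rfl; simp at hD0
  obtain ⟨t, ht⟩ : ∃ t, (r₀ * r₁ * D).eval t ≠ 0 := by
    by_contra! h
    exact mul_ne_zero (mul_ne_zero hr₀' hr₁') hD' (Polynomial.funext fun t => by simpa using h t)
  rw [eval_mul, eval_mul, mul_ne_zero_iff, mul_ne_zero_iff] at ht
  obtain ⟨⟨ht₀, ht₁⟩, htD⟩ := ht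
  obtain ⟨ρ, hρ, hc⟩ := hcurve t htD
  rw [← hr₀ t htD, ← hc] at ht₀
  rw [← hr₁ t htD, ← hc] at ht₁
  rcases hcov hρ with h | h
  · exact ht₀ (by rw [show MvPolynomial.eval (coords n d ρ) f₀ = 0 from h f₀ hf₀, zero_mul])
  · exact ht₁ (by rw [show MvPolynomial.eval (coords n d ρ) f₁ = 0 from h f₁ hf₁, zero_mul])

end IrreducibleOfEquality

theorem zariskiIrreducible_iff {n d : ℕ} (hn : 3 ≤ n) :
    ZariskiIrreducible (primitiveUnipotentReps n d) ↔
      unipotentReps n d = primitiveUnipotentReps n d := by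
  obtain ⟨m, rfl⟩ := Nat.exists_eq_add_of_le' hn
  exact ⟨unipotentReps_eq_of_zariskiIrreducible,
    fun h => h ▸ zariskiIrreducible_unipotentReps (m + 3) d⟩

end PrimUnip

theorem mainTheorem2 :
    (∀ n d : ℕ, 3 ≤ n →
      (PrimUnip.ZariskiIrreducible (PrimUnip.primitiveUnipotentReps n d) ↔
        PrimUnip.unipotentReps n d = PrimUnip.primitiveUnipotentReps n d)) ∧
    ((∀ n d : ℕ, 3 ≤ n →
        PrimUnip.ZariskiIrreducible (PrimUnip.primitiveUnipotentReps n d)) ↔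
      (∀ n d : ℕ, 3 ≤ n →
        PrimUnip.unipotentReps n d = PrimUnip.primitiveUnipotentReps n d)) :=
  ⟨fun _ _ hn => PrimUnip.zariskiIrreducible_iff hn,
    forall₂_congr fun _ _ => forall_congr' PrimUnip.zariskiIrreducible_iff⟩
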